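/- Let $\mathbb N=\{1,2,3,\dots\}$ and let $J_a$ be the bounded operator on $\ell^2(\mathbb N)$ (complex sequences) given by the Jacobi matrix with diagonal $(a,0,0,\dots)$ and all off-diagonal entries equal to $1$; put $-\Delta_a:=2-J_a$. Let $a\in[0,1)$, let $v=\{v_n\}_{n=1}^\infty$ be a sequence of complex numbers, and let $V=\operatorname{diag}(v_1,v_2,\dots)$, $|V|=\operatorname{diag}(|v_1|,|v_2|,\dots)$. Let $K'$ be the semi-infinite matrix with entries $$K'_{m,n}=\sqrt{|v_m|}\left[\frac{a}{1-a}+\min(m,n)\right]\sqrt{|v_n|},\qquad m,n\in\mathbb N,$$ regarded as an operator on $\ell^2(\mathbb N)$. The following two conditions are equivalent: (i) $K'$ is bounded with $\|K'\|\le 1$; (ii) $|V|\le-\Delta_a$ in the sense of quadratic forms, i.e. $\sum_{n}|v_n||\psi_n|^2\le\langle\psi,-\Delta_a\psi\rangle$ for all $\psi\in\ell^2(\mathbb N)$. If either of them holds, then $V$ is bounded and the discrete spectrum of $J_a+V$ is empty: $\sigma_{\mathrm d}(J_a+V)=\emptyset$. Here the discrete spectrum is the set of eigenvalues that are isolated points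 of the spectrum and have finite algebraic multiplicity (finite rank of the Riesz projection). -/

import Mathlib

open scoped ENNReal

noncomputable section

namespace RobinLaplacian

/-- The complex Hilbert space `ℓ²` of square summable sequences. The index `n : ℕ` stands for the
site `n + 1` of `{1, 2, 3, …}`. -/
abbrev SeqSpace : Type := lp (fun _ : ℕ => ℂ) 2

/-- The action on sequences of the tridiagonal matrix with off-diagonal entries `1` and with
diagonal `a, 0, 0, …`. -/
def jacobiFun (a : ℂ) (f : ℕ → ℂ) (n : ℕ) : ℂ :=
  (if n = 0 then a * f 0 else f (n - 1)) + f (n + 1)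

theorem jacobiFun_bound (a : ℂ) (ψ : SeqSpace) :
    Memℓp (jacobiFun a ψ) 2 ∧
      ∑' n, ‖jacobiFun a ψ n‖ ^ 2 ≤ (2 * ‖a‖ ^ 2 + 4) * ‖ψ‖ ^ 2 := by
  have hs : Summable fun n => ‖ψ n‖ ^ 2 := by
    simpa using (lp.memℓp ψ).summable (by norm_num)
  have hn : ‖ψ‖ ^ 2 = ∑' n, ‖ψ n‖ ^ 2 := by
    simpa using lp.norm_rpow_eq_tsum (p := 2) (by norm_num) ψ
  have hR := (summable_nat_add_iff 1).2 hs
  have hL : Summable fun n : ℕ => if n = 0 then ‖a‖ ^ 2 * ‖ψ 0‖ ^ 2 else ‖ψ (n - 1)‖ ^ 2 := by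
    rw [← summable_nat_add_iff 1]
    simpa using hs
  have hle : ∀ n, ‖jacobiFun a ψ n‖ ^ 2 ≤
      2 * ((if n = 0 then ‖a‖ ^ 2 * ‖ψ 0‖ ^ 2 else ‖ψ (n - 1)‖ ^ 2) + ‖ψ (n + 1)‖ ^ 2) := by
    intro n
    have key : ∀ x y : ℂ, ‖x + y‖ ^ 2 ≤ 2 * (‖x‖ ^ 2 + ‖y‖ ^ 2) := by
      intro x y
      have h1 := norm_add_le x y
      have h2 := norm_nonneg (x + y)
      nlinarith [sq_nonneg (‖x‖ - ‖y‖)]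
    refine (key _ _).trans (le_of_eq ?_)
    split_ifs
    · rw [norm_mul, mul_pow]
    · rfl
  have hsum : Summable fun n => ‖jacobiFun a ψ n‖ ^ 2 :=
    Summable.of_nonneg_of_le (fun n => by positivity) hle ((hL.add hR).mul_left 2)
  refine ⟨memℓp_gen (by simpa using hsum), ?_⟩
  refine (hsum.tsum_le_tsum hle ((hL.add hR).mul_left 2)).trans ?_
  rw [tsum_mul_left, hL.tsum_add hR, hL.tsum_eq_zero_add]
  have h0 : ‖ψ 0‖ ^ 2 ≤ ‖ψ‖ ^ 2 := by
    rw [hn]; exact hs.le_tsum 0 fun _ _ => by positivity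
  have h1 : ∑' n, ‖ψ (n + 1)‖ ^ 2 ≤ ‖ψ‖ ^ 2 := by
    rw [hn, hs.tsum_eq_zero_add]
    have := sq_nonneg ‖ψ 0‖
    linarith
  have h2 : ‖a‖ ^ 2 * ‖ψ 0‖ ^ 2 ≤ ‖a‖ ^ 2 * ‖ψ‖ ^ 2 := by gcongr
  simp only [if_true, Nat.add_eq_zero_iff, one_ne_zero, and_false, if_false, Nat.add_sub_cancel,
    ← hn]
  linarith

/-- The Jacobi operator `J_a` on `ℓ²`. -/
def jacobiOp (a : ℂ) : SeqSpace →L[ℂ] SeqSpace :=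
  LinearMap.mkContinuous
    { toFun := fun ψ => ⟨jacobiFun a ψ, (jacobiFun_bound a ψ).1⟩
      map_add' := fun ψ φ => by
        ext n
        simp only [jacobiFun, lp.coeFn_add, Pi.add_apply]
        split_ifs <;> ring
      map_smul' := fun c ψ => by
        ext n
        simp only [jacobiFun, lp.coeFn_smul, Pi.smul_apply, smul_eq_mul, RingHom.id_apply]
        split_ifs <;> ring }
    (Real.sqrt (2 * ‖a‖ ^ 2 + 4)) (fun ψ => by
      refine le_of_sq_le_sq ?_ (by positivity)
      rw [mul_pow, Real.sq_sqrt (by positivity)]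
      refine le_trans (le_of_eq ?_) (jacobiFun_bound a ψ).2
      simpa using lp.norm_rpow_eq_tsum (p := 2) (by norm_num)
        (⟨jacobiFun a ψ, (jacobiFun_bound a ψ).1⟩ : SeqSpace))

theorem jacobiOp_apply (a : ℂ) (ψ : SeqSpace) (n : ℕ) :
    jacobiOp a ψ n = (if n = 0 then a * ψ 0 else ψ (n - 1)) + ψ (n + 1) := rfl

/-- The discrete Robin Laplacian `-Δ_a = 2 - J_a`. -/
def negLaplacian (a : ℂ) : SeqSpace →L[ℂ] SeqSpace :=
  (2 : ℂ) • ContinuousLinearMap.id ℂ SeqSpace - jacobiOp a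

theorem mul_bound (v : lp (fun _ : ℕ => ℂ) ∞) (ψ : SeqSpace) :
    Memℓp (fun n => v n * ψ n) 2 ∧ ∑' n, ‖v n * ψ n‖ ^ 2 ≤ ‖v‖ ^ 2 * ‖ψ‖ ^ 2 := by
  have hs : Summable fun n => ‖ψ n‖ ^ 2 := by
    simpa using (lp.memℓp ψ).summable (by norm_num)
  have hn : ‖ψ‖ ^ 2 = ∑' n, ‖ψ n‖ ^ 2 := by
    simpa using lp.norm_rpow_eq_tsum (p := 2) (by norm_num) ψ
  have hle : ∀ n, ‖v n * ψ n‖ ^ 2 ≤ ‖v‖ ^ 2 * ‖ψ n‖ ^ 2 := by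
    intro n
    rw [norm_mul, mul_pow]
    have := lp.norm_apply_le_norm ENNReal.top_ne_zero v n
    gcongr
  have hsum : Summable fun n => ‖v n * ψ n‖ ^ 2 :=
    Summable.of_nonneg_of_le (fun n => by positivity) hle (hs.mul_left _)
  refine ⟨memℓp_gen (by simpa using hsum), ?_⟩
  rw [hn, ← tsum_mul_left]
  exact hsum.tsum_le_tsum hle (hs.mul_left _)

/-- The potential `V = diag(v₁, v₂, …)` of a bounded sequence, as an operator on `ℓ²`. -/
def potentialOp (v : lp (fun _ : ℕ => ℂ) ∞) : SeqSpace →L[ℂ] SeqSpace :=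
  LinearMap.mkContinuous
    { toFun := fun ψ => ⟨fun n => v n * ψ n, (mul_bound v ψ).1⟩
      map_add' := fun ψ φ => by
        ext n
        simp only [lp.coeFn_add, Pi.add_apply]
        ring
      map_smul' := fun c ψ => by
        ext n
        simp only [lp.coeFn_smul, Pi.smul_apply, smul_eq_mul, RingHom.id_apply]
        ring }
    ‖v‖ (fun ψ => by
      refine le_of_sq_le_sq ?_ (by positivity)
      rw [mul_pow]
      refine le_trans (le_of_eq ?_) (mul_bound v ψ).2
      simpa using lp.norm_rpow_eq_tsum (p := 2) (by norm_num)
        (⟨fun n => v n * ψ n, (mul_bound v ψ).1⟩ : SeqSpace))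

theorem potentialOp_apply (v : lp (fun _ : ℕ => ℂ) ∞) (ψ : SeqSpace) (n : ℕ) :
    potentialOp v ψ n = v n * ψ n := rfl

/-- The bounded operator `T` on `ℓ²` has the matrix `M` in the standard basis. -/
def HasMatrix (T : SeqSpace →L[ℂ] SeqSpace) (M : ℕ → ℕ → ℂ) : Prop :=
  ∀ m n, (T (lp.single 2 n (1 : ℂ))) m = M m n

/-- The entries `√|v_m| (a / (1 - a) + min(m, n)) √|v_n|` of the matrix `K'`; with the sites
numbered from zero, `min(m, n)` reads `min m n + 1`. -/
def hardyKernel (a : ℝ) (v : ℕ → ℂ) (m n : ℕ) : ℂ :=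
  ((Real.sqrt ‖v m‖ * (a / (1 - a) + ((min m n : ℕ) + 1 : ℝ)) * Real.sqrt ‖v n‖ : ℝ) : ℂ)

/-- The matrix `M`, regarded as an operator on `ℓ²`, is bounded with norm at most `c`. -/
def MatrixNormLE (M : ℕ → ℕ → ℂ) (c : ℝ) : Prop :=
  ∃ T : SeqSpace →L[ℂ] SeqSpace, HasMatrix T M ∧ ‖T‖ ≤ c

/-- The operator inequality `|V| ≤ A` in the sense of quadratic forms on `ℓ²`, for
`V = diag(v₁, v₂, …)` with an arbitrary complex sequence `v` and a bounded symmetric `A`: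
`⟨ψ, |V| ψ⟩ ≤ ⟨ψ, A ψ⟩` for all `ψ`, where the left-hand side is in particular finite. -/
def AbsPotentialLE (v : ℕ → ℂ) (A : SeqSpace →L[ℂ] SeqSpace) : Prop :=
  ∀ ψ : SeqSpace, Summable (fun n => ‖v n‖ * ‖ψ n‖ ^ 2) ∧
    ∑' n, ‖v n‖ * ‖ψ n‖ ^ 2 ≤ (inner ℂ ψ (A ψ)).re

/-- The Riesz integral `(2πi)⁻¹ ∮ (z - T)⁻¹ dz` over the circle of radius `r` about `c`. -/
def rieszProjection {E : Type*} [NormedAddCommGroup E] [NormedSpace ℂ E] [CompleteSpace E]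
    (T : E →L[ℂ] E) (c : ℂ) (r : ℝ) : E →L[ℂ] E :=
  (2 * Real.pi * Complex.I)⁻¹ • circleIntegral (fun z => resolvent T z) c r

/-- The discrete spectrum: the eigenvalues that are isolated points of the spectrum and have finite
algebraic multiplicity (the rank of the Riesz projection). -/
def discreteSpectrum {E : Type*} [NormedAddCommGroup E] [NormedSpace ℂ E] [CompleteSpace E]
    (T : E →L[ℂ] E) : Set ℂ :=
  {μ | Module.End.HasEigenvalue (T : E →ₗ[ℂ] E) μ ∧
    ∃ r : ℝ, 0 < r ∧ spectrum ℂ T ∩ Metric.closedBall μ r = {μ} ∧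
      FiniteDimensional ℂ (LinearMap.range (rieszProjection T μ r : E →ₗ[ℂ] E))}

end RobinLaplacian

end

open RobinLaplacian

namespace RobinLaplacian

/-! Equivalence. Summation by parts gives `-Δ_a = D*D`, where `D ψ` has entries `√(1 - a) ψ₀` and `ψ
n - ψ (n - 1)` (`hasSum_energy`). Formally, `D` is inverted by weighted partial sums, so `B =
|V|^(1/2) D⁻¹` is lower triangular (`hardyFactor`) and `K' = B Bᵀ` (`sum_hardyFactor_mul`). Hence
`‖K'‖ ≤ 1` iff `‖B‖ ≤ 1` iff `|V| ≤ D*D`. As `D⁻¹` may be unbounded, this is argued on finite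
sections.

Discrete spectrum. Write an eigenvalue as `k + k⁻¹` with `‖k‖ ≤ 1`. If `‖k‖ < 1`, the Green function
of `J_a` is dominated entrywise by `‖k‖` times the bracket in `K'` (`norm_greenFun_le`). A
Birman–Schwinger argument then makes `√|v| |ψ|` vanish, and `ψ` with it (`eq_zero_of_eigenvector`).
If `‖k‖ = 1`, the eigenvalue lies in `[-2, 2]`. The diagonal of `K'` forces `‖v n‖ ≤ 1 / (n + 1)`,
so all of `[-2, 2]` is spectrum (`ofReal_mem_spectrum`) and none of its points is isolated. -/

theorem summable_norm_sq (ψ : SeqSpace) : Summable fun n => ‖ψ n‖ ^ 2 := by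
  simpa using (lp.memℓp ψ).summable (by norm_num)

theorem norm_sq_eq_tsum (ψ : SeqSpace) : ‖ψ‖ ^ 2 = ∑' n, ‖ψ n‖ ^ 2 := by
  simpa using lp.norm_rpow_eq_tsum (p := 2) (by norm_num) ψ

theorem memℓp_two_of_summable {f : ℕ → ℂ} (h : Summable fun n => ‖f n‖ ^ 2) : Memℓp f 2 :=
  memℓp_gen (by simpa using h)

theorem sum_norm_sq_le (ψ : SeqSpace) (s : Finset ℕ) : ∑ n ∈ s, ‖ψ n‖ ^ 2 ≤ ‖ψ‖ ^ 2 := by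
  rw [norm_sq_eq_tsum]
  exact (summable_norm_sq ψ).sum_le_tsum s fun _ _ => by positivity

theorem norm_sq_le_of_sum_le {ψ : SeqSpace} {c : ℝ}
    (h : ∀ N, ∑ n ∈ Finset.range N, ‖ψ n‖ ^ 2 ≤ c) : ‖ψ‖ ^ 2 ≤ c := by
  rw [norm_sq_eq_tsum]
  exact (summable_norm_sq ψ).tsum_le_of_sum_range_le h

/-- A finitely supported sequence as an element of `ℓ²`. -/
noncomputable def truncate (N : ℕ) (f : ℕ → ℂ) : SeqSpace :=
  ⟨fun n => if n < N then f n else 0, memℓp_two_of_summable <|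
    summable_of_ne_finset_zero (s := Finset.range N) fun n hn => by
      simp [if_neg (mt Finset.mem_range.2 hn)]⟩

theorem truncate_apply (N : ℕ) (f : ℕ → ℂ) (n : ℕ) :
    truncate N f n = if n < N then f n else 0 := rfl

theorem norm_sq_truncate (N : ℕ) (f : ℕ → ℂ) :
    ‖truncate N f‖ ^ 2 = ∑ n ∈ Finset.range N, ‖f n‖ ^ 2 := by
  rw [norm_sq_eq_tsum, tsum_eq_sum (s := Finset.range N)]
  · refine Finset.sum_congr rfl fun n hn => ?_
    rw [truncate_apply, if_pos (Finset.mem_range.1 hn)]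
  · intro n hn
    rw [truncate_apply, if_neg (mt Finset.mem_range.2 hn)]
    simp

theorem HasMatrix.hasSum {T : SeqSpace →L[ℂ] SeqSpace} {M : ℕ → ℕ → ℂ} (h : HasMatrix T M)
    (φ : SeqSpace) (m : ℕ) : HasSum (fun n => M m n * φ n) (T φ m) := by
  have h1 := (lp.hasSum_single (p := 2) (by norm_num) φ).mapL
    ((lp.evalCLM ℂ (fun _ : ℕ => ℂ) 2 m).comp T)
  have h2 : ∀ n, (lp.evalCLM ℂ (fun _ : ℕ => ℂ) 2 m).comp T (lp.single 2 n (φ n)) =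
      M m n * φ n := fun n => by
    have : lp.single 2 n (φ n) = (φ n) • (lp.single 2 n (1 : ℂ) : SeqSpace) := by
      rw [← lp.single_smul]; simp
    rw [this, map_smul, smul_eq_mul, mul_comm]
    congr 1
    exact h m n
  simp only [h2] at h1
  exact h1

/-! ### The quadratic form of `J_a` -/

theorem summable_shift_mul (f g : SeqSpace) : Summable fun n => star (f (n + 1)) * g n := by
  refine Summable.of_norm_bounded (g := fun n => ‖f (n + 1)‖ ^ 2 + ‖g n‖ ^ 2)
    (((summable_nat_add_iff 1).2 (summable_norm_sq f)).add (summable_norm_sq g)) fun n => ?_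
  rw [norm_mul, norm_star]
  nlinarith [sq_nonneg (‖f (n + 1)‖ - ‖g n‖), sq_nonneg (‖f (n + 1)‖), sq_nonneg ‖g n‖]

theorem summable_mul_shift (f g : SeqSpace) : Summable fun n => star (f n) * g (n + 1) := by
  refine (summable_shift_mul g f).star.congr fun n => ?_
  simp [mul_comm]

theorem inner_jacobiOp (a : ℂ) (f g : SeqSpace) :
    inner ℂ f (jacobiOp a g) = a * (star (f 0) * g 0) + ∑' n, star (f n) * g (n + 1)
      + ∑' n, star (f (n + 1)) * g n := by
  have h1 : HasSum (fun n => star (f n) * (if n = 0 then a * g 0 else g (n - 1)))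
      (a * (star (f 0) * g 0) + ∑' n, star (f (n + 1)) * g n) := by
    rw [← hasSum_nat_add_iff' 1]
    simpa [mul_left_comm] using (summable_shift_mul f g).hasSum
  have h2 := h1.add (summable_mul_shift f g).hasSum
  rw [add_right_comm]
  refine (lp.hasSum_inner f (jacobiOp a g)).unique ?_
  have e : ∀ n, inner ℂ (f n) (jacobiOp a g n) =
      star (f n) * (if n = 0 then a * g 0 else g (n - 1)) + star (f n) * g (n + 1) := fun n => by
    rw [jacobiOp_apply, ← mul_add, RCLike.inner_apply, mul_comm]
    rfl
  simpa only [e] using h2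

theorem inner_jacobiOp_comm (a : ℝ) (f g : SeqSpace) :
    inner ℂ (jacobiOp a f) g = inner ℂ f (jacobiOp a g) := by
  rw [← inner_conj_symm, inner_jacobiOp, inner_jacobiOp]
  have e1 : (∑' n, star (g n) * f (n + 1)) = star (∑' n, star (f (n + 1)) * g n) := by
    rw [tsum_star]; simp [mul_comm]
  have e2 : (∑' n, star (g (n + 1)) * f n) = star (∑' n, star (f n) * g (n + 1)) := by
    rw [tsum_star]; simp [mul_comm]
  rw [e1, e2]
  simp
  ring

theorem hasSum_energy (a : ℝ) (ψ : SeqSpace) :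
    HasSum (fun n => ‖ψ (n + 1) - ψ n‖ ^ 2)
      ((inner ℂ ψ (negLaplacian a ψ)).re - (1 - a) * ‖ψ 0‖ ^ 2) := by
  have hs := summable_norm_sq ψ
  have hs' := (summable_nat_add_iff 1).2 hs
  have h1 := ((hs.hasSum.add hs'.hasSum).sub
    (Complex.hasSum_re (summable_mul_shift ψ ψ).hasSum)).sub
    (Complex.hasSum_re (summable_shift_mul ψ ψ).hasSum)
  have e0 : ∀ n, ‖ψ (n + 1) - ψ n‖ ^ 2 = ‖ψ n‖ ^ 2 + ‖ψ (n + 1)‖ ^ 2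
      - (star (ψ n) * ψ (n + 1)).re - (star (ψ (n + 1)) * ψ n).re := fun n => by
    rw [Complex.sq_norm, Complex.sq_norm, Complex.sq_norm]
    simp [Complex.normSq_apply]
    ring
  have e : negLaplacian (a : ℂ) ψ = (2 : ℂ) • ψ - jacobiOp a ψ := rfl
  have e2 := hs.tsum_eq_zero_add
  have e3 : (inner ℂ ψ ((2 : ℂ) • ψ)).re = 2 * ‖ψ‖ ^ 2 := by
    have h : (inner ℂ ψ ψ).re = ‖ψ‖ ^ 2 := inner_self_eq_norm_sq (𝕜 := ℂ) ψ
    rw [two_smul, inner_add_right, Complex.add_re, h, two_mul]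
  have e4 : ((a : ℂ) * (star (ψ 0) * ψ 0)).re = a * ‖ψ 0‖ ^ 2 := by
    rw [Complex.re_ofReal_mul, Complex.sq_norm]; simp [Complex.normSq_apply]
  have e5 : (inner ℂ ψ (negLaplacian (a : ℂ) ψ)).re - (1 - a) * ‖ψ 0‖ ^ 2 =
      ∑' n, ‖ψ n‖ ^ 2 + ∑' n, ‖ψ (n + 1)‖ ^ 2 - (∑' n, star (ψ n) * ψ (n + 1)).re
        - (∑' n, star (ψ (n + 1)) * ψ n).re := by
    rw [e, inner_sub_right, Complex.sub_re, e3, inner_jacobiOp, Complex.add_re, Complex.add_re, e4,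
      norm_sq_eq_tsum]
    linarith
  rw [e5]
  simpa only [e0] using h1


/-! ### The Green function of `J_a` -/

/-- The normalised factor of the Green function of `J_a` at the energy `k + k⁻¹`. -/
noncomputable def greenFactor (a k : ℂ) (p : ℕ) : ℂ :=
  ∑ j ∈ Finset.range p, k ^ (2 * j) + k ^ (2 * p) / (1 - a * k)

/-- The Green function of `J_a` at the energy `k + k⁻¹`, where `‖k‖ < 1`. -/
noncomputable def greenFun (a k : ℂ) (m n : ℕ) : ℂ :=
  -(k ^ (max m n - min m n + 1) * greenFactor a k (min m n))

theorem greenFun_add_left (a k : ℂ) (n d : ℕ) :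
    greenFun a k (n + d) n = -(k ^ (d + 1) * greenFactor a k n) := by
  simp [greenFun]

theorem greenFun_add_right (a k : ℂ) (m d : ℕ) :
    greenFun a k m (m + d) = -(k ^ (d + 1) * greenFactor a k m) := by
  simp [greenFun]

theorem greenFactor_zero (a k : ℂ) : greenFactor a k 0 = 1 / (1 - a * k) := by
  simp [greenFactor]

theorem greenFactor_succ {a k : ℂ} (h : 1 - a * k ≠ 0) (p : ℕ) :
    greenFactor a k (p + 1) = greenFactor a k p + k ^ (2 * p) * (k * (k - a) / (1 - a * k)) := by
  rw [greenFactor, greenFactor, Finset.sum_range_succ]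
  field_simp
  ring

/-- For `n < m` the row solves the recurrence with the boundary condition at `0`; for `n > m` it is
geometric. The two solutions are matched at `n = m`, where the unit source appears. -/
theorem jacobiFun_greenFun {a k : ℂ} (hk : k ≠ 0) (h : 1 - a * k ≠ 0) (m n : ℕ) :
    jacobiFun a (greenFun a k m) n =
      (k + k⁻¹) * greenFun a k m n + if n = m then 1 else 0 := by
  rw [jacobiFun]
  rcases lt_trichotomy n m with hlt | rfl | hlt
  · obtain ⟨d, rfl⟩ : ∃ d, m = n + 1 + d := ⟨m - (n + 1), by omega⟩
    rw [greenFun_add_left, show n + 1 + d = n + (d + 1) by ring, greenFun_add_left,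
      greenFactor_succ h]
    rcases n with _ | n
    · rw [if_pos rfl, greenFun_add_left, greenFactor_zero, if_neg (by omega)]
      field_simp
      ring
    · rw [if_neg (by omega), if_neg (by omega), Nat.add_sub_cancel,
        show n + 1 + (d + 1) = n + (d + 2) by ring, greenFun_add_left, greenFactor_succ h]
      field_simp
      ring
  · rw [greenFun_add_right a k n 1, show greenFun a k n n = _ from greenFun_add_right a k n 0,
      if_pos rfl]
    rcases n with _ | n
    · rw [if_pos rfl, show greenFun a k 0 0 = _ from greenFun_add_right a k 0 0, greenFactor_zero]
      field_simp
      ring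
    -- The geometric sum in closed form, multiplied out so that `k ^ 2 = 1` needs no separate
    -- treatment.
    · have hA : greenFactor a k n * (1 - k ^ 2) = 1 + k ^ (2 * n) * (k * (a - k) / (1 - a * k)) := by
        induction n with
        | zero => rw [greenFactor_zero]; field_simp; ring
        | succ n ih =>
          rw [greenFactor_succ h, add_mul, ih]
          field_simp
          ring
      rw [if_neg (by omega), Nat.add_sub_cancel, greenFun_add_left, greenFactor_succ h]
      field_simp
      field_simp at hA
      linear_combination k * hA
  · obtain ⟨d, rfl⟩ : ∃ d, n = m + (d + 1) := ⟨n - (m + 1), by omega⟩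
    rw [if_neg (by omega), if_neg (by omega), show m + (d + 1) - 1 = m + d by omega, add_assoc,
      greenFun_add_right, greenFun_add_right, greenFun_add_right]
    field_simp
    ring

/-- Each power of `k` is replaced by its value at the threshold `k = 1`, except one spare factor
`‖k‖`, which later gives a strict contraction. -/
theorem norm_greenFun_le {a : ℝ} (ha0 : 0 ≤ a) (ha1 : a < 1) {k : ℂ} (hk : ‖k‖ ≤ 1) (m n : ℕ) :
    ‖greenFun a k m n‖ ≤ ‖k‖ * (a / (1 - a) + ((min m n : ℕ) + 1)) := by
  have h1 : 1 - a ≤ ‖1 - (a : ℂ) * k‖ := by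
    have := norm_sub_norm_le (1 : ℂ) (a * k)
    rw [norm_mul, norm_one, Complex.norm_real, Real.norm_of_nonneg ha0] at this
    nlinarith
  have h2 : ∀ j : ℕ, ‖k ^ j‖ ≤ 1 := fun j => by
    rw [norm_pow]; exact pow_le_one₀ (norm_nonneg _) hk
  have h3 : ‖greenFactor a k (min m n)‖ ≤ (min m n : ℕ) + 1 / (1 - a) := by
    refine (norm_add_le _ _).trans (add_le_add ?_ ?_)
    · refine (norm_sum_le_of_le _ fun j _ => h2 (2 * j)).trans ?_
      simp
    · rw [norm_div]
      have := h2 (2 * min m n)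
      have : 0 < 1 - a := by linarith
      gcongr
  have h4 : a / (1 - a) + (((min m n : ℕ) : ℝ) + 1) = (min m n : ℕ) + 1 / (1 - a) := by
    have : 1 - a ≠ 0 := by linarith
    field_simp
    ring
  rw [greenFun, norm_neg, pow_succ', norm_mul, norm_mul, h4, mul_assoc]
  refine mul_le_mul_of_nonneg_left ?_ (norm_nonneg _)
  exact (mul_le_of_le_one_left (norm_nonneg _) (h2 _)).trans h3

theorem summable_greenFun (a : ℂ) {k : ℂ} (hk : ‖k‖ < 1) (m : ℕ) :
    Summable fun n => ‖greenFun a k m n‖ ^ 2 := by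
  rw [← summable_nat_add_iff m]
  have : Summable fun n : ℕ => (‖k‖ ^ 2) ^ n :=
    summable_geometric_of_lt_one (by positivity) (by nlinarith [norm_nonneg k])
  refine (this.mul_left (‖k‖ ^ 2 * ‖greenFactor a k m‖ ^ 2)).congr fun n => ?_
  rw [add_comm n m, greenFun_add_right, norm_neg, norm_mul, norm_pow]
  ring


/-! ### Factorisation of `K'` and the equivalence -/

/-- The weights `b_j` for which `a / (1 - a) + min(m, n) + 1` is the sum of `b_j ^ 2` over
`j ≤ min(m, n)`. -/
noncomputable def hardyWeight (a : ℝ) (j : ℕ) : ℝ := if j = 0 then (√(1 - a))⁻¹ else 1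

theorem sum_hardyWeight_sq {a : ℝ} (ha1 : a < 1) (p : ℕ) :
    ∑ j ∈ Finset.range (p + 1), hardyWeight a j ^ 2 = a / (1 - a) + (p + 1) := by
  have h : 0 < 1 - a := by linarith
  rw [Finset.sum_range_succ']
  simp only [hardyWeight, Nat.add_eq_zero_iff, one_ne_zero, and_false, if_false, if_true, one_pow,
    Finset.sum_const, Finset.card_range, nsmul_eq_mul, mul_one, inv_pow, Real.sq_sqrt h.le]
  field_simp
  ring

/-- The lower triangular factor of the matrix `K'`. -/
noncomputable def hardyFactor (a : ℝ) (v : ℕ → ℂ) (m j : ℕ) : ℝ :=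
  if j < m + 1 then √‖v m‖ * hardyWeight a j else 0

theorem sum_hardyFactor_mul {a : ℝ} (ha1 : a < 1) (v : ℕ → ℂ) {m n N : ℕ} (h : min m n < N) :
    ((∑ j ∈ Finset.range N, hardyFactor a v m j * hardyFactor a v n j : ℝ) : ℂ) =
      hardyKernel a v m n := by
  rw [hardyKernel, ← sum_hardyWeight_sq ha1, Complex.ofReal_inj, Finset.mul_sum, Finset.sum_mul]
  symm
  refine Finset.sum_subset_zero_on_sdiff (fun j hj => ?_) (fun j hj => ?_) fun j hj => ?_
  · simp only [Finset.mem_range] at hj ⊢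
    omega
  · simp only [Finset.mem_sdiff, Finset.mem_range] at hj
    rw [hardyFactor, hardyFactor]
    split_ifs
    · omega
    all_goals simp
  · simp only [Finset.mem_range] at hj
    rw [hardyFactor, hardyFactor, if_pos (by omega), if_pos (by omega)]
    ring

/-- The left side is `‖Bᵀ x‖²` for a finite section of `B`, and equals `⟨ξ, K' ξ⟩` for the
truncation `ξ` of `x`. -/
theorem sum_sq_sum_hardyFactor_le {a : ℝ} (ha1 : a < 1) {v : ℕ → ℂ}
    (h : MatrixNormLE (hardyKernel a v) 1) (x : ℕ → ℝ) (N : ℕ) :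
    ∑ j ∈ Finset.range N, (∑ m ∈ Finset.range N, hardyFactor a v m j * x m) ^ 2 ≤
      ∑ m ∈ Finset.range N, x m ^ 2 := by
  obtain ⟨T, hT, hT1⟩ := h
  set ξ : SeqSpace := truncate N fun n => (x n : ℂ) with hξ
  have hξn : ‖ξ‖ ^ 2 = ∑ m ∈ Finset.range N, x m ^ 2 := by
    rw [hξ, norm_sq_truncate]
    simp
  have hTξ : ∀ m, T ξ m = ∑ n ∈ Finset.range N, hardyKernel a v m n * x n := fun m => by
    refine (hT.hasSum ξ m).unique ?_
    have : ∑ n ∈ Finset.range N, hardyKernel a v m n * x n =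
        ∑ n ∈ Finset.range N, hardyKernel a v m n * ξ n :=
      Finset.sum_congr rfl fun n hn => by
        rw [hξ, truncate_apply, if_pos (Finset.mem_range.1 hn)]
    rw [this]
    refine hasSum_sum_of_ne_finset_zero fun n hn => ?_
    rw [hξ, truncate_apply, if_neg (mt Finset.mem_range.2 hn), mul_zero]
  have hin : inner ℂ ξ (T ξ) =
      ((∑ j ∈ Finset.range N, (∑ m ∈ Finset.range N, hardyFactor a v m j * x m) ^ 2 : ℝ) : ℂ) := by
    have h1 : inner ℂ ξ (T ξ) = ∑ m ∈ Finset.range N, (x m : ℂ) * T ξ m := by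
      refine (lp.hasSum_inner ξ (T ξ)).unique ?_
      have : ∑ m ∈ Finset.range N, (x m : ℂ) * T ξ m =
          ∑ m ∈ Finset.range N, inner ℂ (ξ m) (T ξ m) :=
        Finset.sum_congr rfl fun n hn => by
          rw [hξ, truncate_apply, if_pos (Finset.mem_range.1 hn)]
          simp [mul_comm]
      rw [this]
      refine hasSum_sum_of_ne_finset_zero fun n hn => ?_
      rw [hξ, truncate_apply, if_neg (mt Finset.mem_range.2 hn), inner_zero_left]
    have h2 : ∀ j, (∑ m ∈ Finset.range N, hardyFactor a v m j * x m) ^ 2 =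
        ∑ m ∈ Finset.range N, ∑ n ∈ Finset.range N,
          x m * (hardyFactor a v m j * hardyFactor a v n j * x n) := fun j => by
      rw [sq, Finset.sum_mul_sum]
      refine Finset.sum_congr rfl fun m _ => Finset.sum_congr rfl fun n _ => by ring
    simp only [h2]
    rw [h1, Finset.sum_comm, Complex.ofReal_sum]
    refine Finset.sum_congr rfl fun m hm => ?_
    rw [hTξ, Finset.sum_comm, Complex.ofReal_sum, Finset.mul_sum]
    refine Finset.sum_congr rfl fun n _ => ?_
    rw [← Finset.mul_sum, ← Finset.sum_mul, Complex.ofReal_mul, Complex.ofReal_mul,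
      sum_hardyFactor_mul ha1 v ((min_le_left _ _).trans_lt (Finset.mem_range.1 hm))]
  have h3 : ‖inner ℂ ξ (T ξ)‖ ≤ ‖ξ‖ ^ 2 := by
    refine (norm_inner_le_norm _ _).trans ?_
    rw [sq]
    refine mul_le_mul_of_nonneg_left ?_ (norm_nonneg _)
    exact (T.le_of_opNorm_le hT1 ξ).trans (one_mul _).le
  rw [hin, Complex.norm_real, hξn] at h3
  exact (le_abs_self _).trans h3

theorem absPotentialLE_of_matrixNormLE {a : ℝ} (ha1 : a < 1) {v : ℕ → ℂ}
    (h : MatrixNormLE (hardyKernel a v) 1) : AbsPotentialLE v (negLaplacian (a : ℂ)) := by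
  intro ψ
  have hpos : 0 < 1 - a := by linarith
  have hsq : √(1 - a) ≠ 0 := (Real.sqrt_pos.2 hpos).ne'
  set r : ℕ → ℝ := fun n => ‖ψ n‖ with hr
  -- `d = D |ψ|`. Passing to moduli does not increase the energy, by the reverse triangle
  -- inequality, and makes everything real.
  set d : ℕ → ℝ := fun n => if n = 0 then √(1 - a) * r 0 else r n - r (n - 1) with hd
  set E : ℝ := (inner ℂ ψ (negLaplacian (a : ℂ) ψ)).re with hE
  have henergy := hasSum_energy a ψ
  have hd_sum : ∀ N, ∑ j ∈ Finset.range N, d j ^ 2 ≤ E := by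
    intro N
    refine (Finset.sum_le_sum_of_subset_of_nonneg (Finset.range_subset_range.2 N.le_succ)
      fun _ _ _ => sq_nonneg _).trans ?_
    rw [Finset.sum_range_succ']
    have h1 : ∑ j ∈ Finset.range N, d (j + 1) ^ 2 ≤ E - (1 - a) * ‖ψ 0‖ ^ 2 := by
      refine le_trans (Finset.sum_le_sum fun j _ => ?_)
        (sum_le_hasSum (Finset.range N) (fun _ _ => by positivity) henergy)
      simp only [hd, hr, if_neg (Nat.succ_ne_zero j), Nat.add_sub_cancel]
      rw [← sq_abs]
      gcongr
      exact abs_norm_sub_norm_le _ _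
    have h2 : d 0 ^ 2 = (1 - a) * ‖ψ 0‖ ^ 2 := by
      simp only [hd, hr, if_true, mul_pow, Real.sq_sqrt hpos.le]
    linarith
  have hr_sum : ∀ n, ∑ j ∈ Finset.range (n + 1), hardyWeight a j * d j = r n := by
    intro n
    induction n with
    | zero => simp [hardyWeight, hd, hsq]
    | succ n ih =>
      rw [Finset.sum_range_succ, ih]
      simp [hardyWeight, hd]
  have hbound : ∀ N, ∑ n ∈ Finset.range N, ‖v n‖ * ‖ψ n‖ ^ 2 ≤ E := by
    intro N
    set S := ∑ n ∈ Finset.range N, ‖v n‖ * ‖ψ n‖ ^ 2 with hS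
    set x : ℕ → ℝ := fun n => √‖v n‖ * r n with hx
    have hxS : ∑ n ∈ Finset.range N, x n ^ 2 = S :=
      Finset.sum_congr rfl fun n _ => by rw [hx, mul_pow, Real.sq_sqrt (norm_nonneg _)]
    have hfac : ∀ n ∈ Finset.range N, x n = ∑ j ∈ Finset.range N, hardyFactor a v n j * d j := by
      intro n hn
      have hn' := Finset.mem_range.1 hn
      simp only [hx]
      rw [← hr_sum n, Finset.mul_sum]
      refine Finset.sum_subset_zero_on_sdiff (Finset.range_subset_range.2 hn') (fun j hj => ?_)
        fun j hj => ?_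
      · simp only [Finset.mem_sdiff, Finset.mem_range] at hj
        rw [hardyFactor, if_neg hj.2, zero_mul]
      · rw [hardyFactor, if_pos (Finset.mem_range.1 hj), mul_assoc]
    -- Duality: `S = ⟨x, B d⟩ = ⟨Bᵀ x, d⟩`, so Cauchy–Schwarz yields `S² ≤ S E`.
    have hSy : S = ∑ j ∈ Finset.range N,
        (∑ n ∈ Finset.range N, hardyFactor a v n j * x n) * d j := by
      rw [← hxS]
      simp only [Finset.sum_mul]
      rw [Finset.sum_comm]
      refine Finset.sum_congr rfl fun n hn => ?_
      rw [sq]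
      nth_rewrite 2 [hfac n hn]
      rw [Finset.mul_sum]
      exact Finset.sum_congr rfl fun j _ => by ring
    have hcs := Finset.sum_mul_sq_le_sq_mul_sq (Finset.range N)
      (fun j => ∑ n ∈ Finset.range N, hardyFactor a v n j * x n) d
    rw [← hSy] at hcs
    have h1 := sum_sq_sum_hardyFactor_le ha1 h x N
    rw [hxS] at h1
    have h2 := hd_sum N
    have h3 : 0 ≤ ∑ j ∈ Finset.range N, d j ^ 2 := Finset.sum_nonneg fun _ _ => sq_nonneg _
    have hS0 : 0 ≤ S := Finset.sum_nonneg fun _ _ => by positivity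
    rcases hS0.eq_or_lt with h0 | h0
    · rw [← h0]; exact h3.trans h2
    · refine le_of_mul_le_mul_left ?_ h0
      calc S * S = S ^ 2 := (sq S).symm
        _ ≤ _ := hcs
        _ ≤ S * E := mul_le_mul h1 h2 h3 hS0
  exact ⟨summable_of_sum_range_le (fun _ => by positivity) hbound,
    Real.tsum_le_of_sum_range_le (fun _ => by positivity) hbound⟩

/-- The form inequality is tested on `P = D⁻¹ y`. Since `P` need not be in `ℓ²`, it is continued
beyond `M` by a linear ramp to zero of length `L`, which costs energy `‖P M‖² / L`, negligible as `L
→ ∞`. -/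
theorem sum_hardyWeight_le {a : ℝ} (ha1 : a < 1) {v : ℕ → ℂ}
    (h : AbsPotentialLE v (negLaplacian (a : ℂ))) (y : ℕ → ℂ) (M : ℕ) :
    ∑ m ∈ Finset.range (M + 1), ‖v m‖ * ‖∑ j ∈ Finset.range (m + 1), hardyWeight a j * y j‖ ^ 2 ≤
      ∑ j ∈ Finset.range (M + 1), ‖y j‖ ^ 2 := by
  have hpos : 0 < 1 - a := by linarith
  set P : ℕ → ℂ := fun m => ∑ j ∈ Finset.range (m + 1), hardyWeight a j * y j with hP
  have hP0 : (1 - a) * ‖P 0‖ ^ 2 = ‖y 0‖ ^ 2 := by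
    simp only [hP, zero_add, Finset.sum_range_one, hardyWeight, if_true, norm_mul, mul_pow,
      Complex.norm_real, Real.norm_eq_abs, sq_abs, inv_pow, Real.sq_sqrt hpos.le]
    field_simp
  have hPs : ∀ n, P (n + 1) - P n = y (n + 1) := fun n => by
    simp only [hP]
    rw [Finset.sum_range_succ _ (n + 1)]
    simp [hardyWeight]
  have key : ∀ L : ℕ, 0 < L → ∑ m ∈ Finset.range (M + 1), ‖v m‖ * ‖P m‖ ^ 2 ≤
      ∑ j ∈ Finset.range (M + 1), ‖y j‖ ^ 2 + ‖P M‖ ^ 2 / L := by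
    intro L hL
    have hL' : (L : ℝ) ≠ 0 := by positivity
    have hLc : (L : ℂ) ≠ 0 := by exact_mod_cast hL'
    -- Subtraction in `ℕ` makes the ramp factor equal to `1` up to `M`; it reaches `0` at `M + L`,
    -- so truncating there creates no jump.
    set f : ℕ → ℂ := fun n => P (min n M) * (1 - ((n - M : ℕ) : ℂ) / L) with hf
    set ψ := truncate (M + L) f with hψ
    have hψf : ∀ n ≤ M + L, ψ n = f n := by
      intro n hn
      rw [hψ, truncate_apply]
      split_ifs with h1
      · rfl
      · obtain rfl : n = M + L := by omega
        simp [hf, hLc]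
    have hψM : ∀ n ≤ M, ψ n = P n := by
      intro n hn
      rw [hψf n (by omega)]
      simp [hf, hn]
    have hE := (hasSum_energy a ψ).unique
      (hasSum_sum_of_ne_finset_zero (s := Finset.range (M + L)) fun n hn => by
        have hn' := mt Finset.mem_range.2 hn
        rw [hψ, truncate_apply, truncate_apply, if_neg hn', if_neg (by omega)]
        simp)
    have h1 : ∑ n ∈ Finset.range (M + L), ‖ψ (n + 1) - ψ n‖ ^ 2 =
        ∑ n ∈ Finset.range M, ‖y (n + 1)‖ ^ 2 + ‖P M‖ ^ 2 / L := by
      rw [Finset.sum_range_add]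
      congr 1
      · refine Finset.sum_congr rfl fun n hn => ?_
        have := Finset.mem_range.1 hn
        rw [hψM _ (by omega), hψM _ (by omega), hPs]
      · have : ∀ i ∈ Finset.range L, ‖ψ (M + i + 1) - ψ (M + i)‖ ^ 2 = ‖P M‖ ^ 2 / L ^ 2 := by
          intro i hi
          have := Finset.mem_range.1 hi
          rw [hψf _ (by omega), hψf _ (by omega)]
          have e : f (M + i + 1) - f (M + i) = -(P M / L) := by
            simp only [hf, min_eq_right (show M ≤ M + i + 1 by omega),
              min_eq_right (show M ≤ M + i by omega), show M + i + 1 - M = i + 1 by omega,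
              Nat.add_sub_cancel_left]
            push_cast
            ring
          rw [e, norm_neg, norm_div, div_pow, Complex.norm_natCast]
        rw [Finset.sum_congr rfl this, Finset.sum_const, Finset.card_range, nsmul_eq_mul]
        field_simp
    have h2 : ∑ m ∈ Finset.range (M + 1), ‖v m‖ * ‖P m‖ ^ 2 ≤
        (inner ℂ ψ (negLaplacian (a : ℂ) ψ)).re := by
      refine le_trans (le_of_eq ?_)
        (((h ψ).1.sum_le_tsum (Finset.range (M + 1)) fun _ _ => by positivity).trans (h ψ).2)
      refine Finset.sum_congr rfl fun n hn => ?_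
      rw [hψM n (by have := Finset.mem_range.1 hn; omega)]
    rw [h1, hψM 0 (Nat.zero_le _), hP0] at hE
    rw [Finset.sum_range_succ' (fun j => ‖y j‖ ^ 2)]
    linarith
  have hlim : Filter.Tendsto
      (fun L : ℕ => ∑ j ∈ Finset.range (M + 1), ‖y j‖ ^ 2 + ‖P M‖ ^ 2 / L) Filter.atTop
      (nhds (∑ j ∈ Finset.range (M + 1), ‖y j‖ ^ 2 + 0)) :=
    (tendsto_const_div_atTop_nhds_zero_nat _).const_add _
  rw [add_zero] at hlim
  exact ge_of_tendsto hlim ((Filter.eventually_gt_atTop 0).mono key)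

/-- The action of the lower triangular factor on sequences. -/
noncomputable def hardyFactorFun (a : ℝ) (v : ℕ → ℂ) (y : ℕ → ℂ) (m : ℕ) : ℂ :=
  ∑ j ∈ Finset.range (m + 1), (hardyFactor a v m j : ℂ) * y j

theorem hardyFactorFun_bound {a : ℝ} (ha1 : a < 1) {v : ℕ → ℂ}
    (h : AbsPotentialLE v (negLaplacian (a : ℂ))) (y : SeqSpace) :
    Memℓp (hardyFactorFun a v y) 2 ∧ ∑' n, ‖hardyFactorFun a v y n‖ ^ 2 ≤ ‖y‖ ^ 2 := by
  have hb : ∀ N, ∑ m ∈ Finset.range N, ‖hardyFactorFun a v y m‖ ^ 2 ≤ ‖y‖ ^ 2 := by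
    intro N
    have e : ∀ m, ‖hardyFactorFun a v y m‖ ^ 2 =
        ‖v m‖ * ‖∑ j ∈ Finset.range (m + 1), hardyWeight a j * y j‖ ^ 2 := fun m => by
      have : hardyFactorFun a v y m =
          (√‖v m‖ : ℂ) * ∑ j ∈ Finset.range (m + 1), hardyWeight a j * y j := by
        rw [hardyFactorFun, Finset.mul_sum]
        refine Finset.sum_congr rfl fun j hj => ?_
        rw [hardyFactor, if_pos (Finset.mem_range.1 hj), Complex.ofReal_mul, mul_assoc]
      rw [this, norm_mul, mul_pow, Complex.norm_real, Real.norm_eq_abs, sq_abs,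
        Real.sq_sqrt (norm_nonneg _)]
    simp only [e]
    refine (Finset.sum_le_sum_of_subset_of_nonneg (Finset.range_subset_range.2 N.le_succ)
      fun _ _ _ => by positivity).trans ?_
    exact (sum_hardyWeight_le ha1 h y N).trans (sum_norm_sq_le y _)
  exact ⟨memℓp_two_of_summable (summable_of_sum_range_le (fun _ => by positivity) hb),
    Real.tsum_le_of_sum_range_le (fun _ => by positivity) hb⟩

theorem matrixNormLE_of_absPotentialLE {a : ℝ} (ha1 : a < 1) {v : ℕ → ℂ}
    (h : AbsPotentialLE v (negLaplacian (a : ℂ))) : MatrixNormLE (hardyKernel a v) 1 := by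
  let B₀ : SeqSpace →ₗ[ℂ] SeqSpace :=
    { toFun := fun y => ⟨hardyFactorFun a v y, (hardyFactorFun_bound ha1 h y).1⟩
      map_add' := fun y z => by
        ext n
        simp only [hardyFactorFun, lp.coeFn_add, Pi.add_apply, mul_add, Finset.sum_add_distrib]
      map_smul' := fun c y => by
        ext n
        simp only [hardyFactorFun, lp.coeFn_smul, Pi.smul_apply, smul_eq_mul, RingHom.id_apply,
          Finset.mul_sum, mul_left_comm] }
  have hB₀ : ∀ y, ‖B₀ y‖ ≤ 1 * ‖y‖ := fun y => by
    rw [one_mul]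
    refine le_of_sq_le_sq ?_ (norm_nonneg _)
    rw [norm_sq_eq_tsum (B₀ y)]
    exact (hardyFactorFun_bound ha1 h y).2
  let B : SeqSpace →L[ℂ] SeqSpace := B₀.mkContinuous 1 hB₀
  have hB : ∀ y m, B y m = ∑ j ∈ Finset.range (m + 1), (hardyFactor a v m j : ℂ) * y j :=
    fun _ _ => rfl
  have hB1 : ‖B‖ ≤ 1 := B₀.mkContinuous_norm_le zero_le_one hB₀
  have hBs : ∀ j n, B (lp.single 2 j 1) n = hardyFactor a v n j := by
    intro j n
    rw [hB]
    simp only [lp.single_apply, Pi.single_apply, mul_ite, mul_one, mul_zero,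
      Finset.sum_ite_eq', Finset.mem_range]
    split_ifs with hj
    · rfl
    · rw [hardyFactor, if_neg hj, Complex.ofReal_zero]
  have hadj : ∀ n j, (ContinuousLinearMap.adjoint B (lp.single 2 n (1 : ℂ))) j =
      hardyFactor a v n j := by
    intro n j
    have h1 := lp.inner_single_left (𝕜 := ℂ) j (1 : ℂ)
      (ContinuousLinearMap.adjoint B (lp.single 2 n (1 : ℂ)))
    rw [ContinuousLinearMap.adjoint_inner_right, ← inner_conj_symm, lp.inner_single_left, hBs] at h1
    simpa using h1.symm
  -- `K'` is realised as `B B*`, with norm at most `‖B‖² ≤ 1`.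
  refine ⟨B.comp (ContinuousLinearMap.adjoint B), fun m n => ?_, ?_⟩
  · rw [ContinuousLinearMap.comp_apply, hB]
    simp only [hadj]
    rw [← sum_hardyFactor_mul ha1 v (N := m + 1) (by omega)]
    push_cast
    rfl
  · refine (ContinuousLinearMap.opNorm_comp_le _ _).trans ?_
    rw [LinearIsometryEquiv.norm_map]
    exact mul_le_one₀ hB1 (norm_nonneg _) hB1

/-! ### Decay of the potential and absence of eigenvalues `k + k⁻¹` with `‖k‖ < 1` -/

theorem norm_le_of_matrixNormLE {a : ℝ} (ha0 : 0 ≤ a) (ha1 : a < 1) {v : ℕ → ℂ}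
    (h : MatrixNormLE (hardyKernel a v) 1) (n : ℕ) : ‖v n‖ ≤ 1 / ((n : ℝ) + 1) := by
  obtain ⟨T, hT, hT1⟩ := h
  have h1 : ‖hardyKernel a v n n‖ ≤ 1 := by
    rw [← hT n n]
    refine (lp.norm_apply_le_norm (by norm_num) _ n).trans ((T.le_of_opNorm_le hT1 _).trans ?_)
    rw [lp.norm_single (by norm_num)]
    simp
  have h2 : 0 ≤ a / (1 - a) := div_nonneg ha0 (by linarith)
  rw [hardyKernel, Complex.norm_real, min_self, mul_right_comm, Real.mul_self_sqrt (norm_nonneg _),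
    Real.norm_of_nonneg (by positivity)] at h1
  rw [le_div_iff₀ (by positivity)]
  nlinarith [mul_nonneg (norm_nonneg (v n)) h2]


/-- The symmetry of `J_a` is applied to `ψ` and a row of the Green function. The row is taken at
`star k` because the inner product conjugates its first argument. -/
theorem exists_apply_eq_neg_inner_greenFun {a : ℝ} (ha0 : 0 ≤ a) (ha1 : a < 1) {k : ℂ} (hk0 : k ≠ 0)
    (hk : ‖k‖ < 1) {W : SeqSpace →L[ℂ] SeqSpace} {ψ : SeqSpace}
    (hψ : (jacobiOp (a : ℂ) + W) ψ = (k + k⁻¹) • ψ) (m : ℕ) :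
    ∃ g : SeqSpace, (∀ n, g n = greenFun a (star k) m n) ∧ ψ m = -inner ℂ g (W ψ) := by
  let g : SeqSpace := ⟨greenFun a (star k) m, memℓp_two_of_summable
      (summable_greenFun a (by rwa [norm_star]) m)⟩
  refine ⟨g, fun _ => rfl, ?_⟩
  have h1 : 1 - (a : ℂ) * star k ≠ 0 := by
    intro h
    have h2 : ‖(a : ℂ) * star k‖ = 1 := by rw [← sub_eq_zero.1 h, norm_one]
    rw [norm_mul, norm_star, Complex.norm_real, Real.norm_of_nonneg ha0] at h2
    nlinarith [norm_nonneg k]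
  have hJg : jacobiOp (a : ℂ) g = (star k + (star k)⁻¹) • g + lp.single 2 m (1 : ℂ) := by
    ext n
    refine (jacobiFun_greenFun (star_ne_zero.2 hk0) h1 m n).trans ?_
    rw [lp.coeFn_add, Pi.add_apply, lp.coeFn_smul, Pi.smul_apply, lp.single_apply, Pi.single_apply,
      smul_eq_mul]
  have hJψ : jacobiOp (a : ℂ) ψ = (k + k⁻¹) • ψ - W ψ := by
    rw [← hψ, add_apply, add_sub_cancel_right]
  have h2 := inner_jacobiOp_comm a g ψ
  rw [hJg, hJψ, inner_add_left, inner_smul_left, inner_sub_right, inner_smul_right,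
    lp.inner_single_left] at h2
  simp only [RCLike.star_def, map_add, map_inv₀, Complex.conj_conj] at h2
  have h3 : inner ℂ (1 : ℂ) (ψ m) = ψ m := by simp
  rw [h3] at h2
  linear_combination h2

theorem eq_zero_of_eigenvector {a : ℝ} (ha0 : 0 ≤ a) (ha1 : a < 1) {v : ℕ → ℂ}
    (h : MatrixNormLE (hardyKernel a v) 1) (hv : Memℓp v ⊤) {k : ℂ} (hk0 : k ≠ 0)
    (hk : ‖k‖ < 1) {ψ : SeqSpace}
    (hψ : (jacobiOp (a : ℂ) + potentialOp ⟨v, hv⟩) ψ = (k + k⁻¹) • ψ) : ψ = 0 := by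
  have hv1 : ∀ n, ‖v n‖ ≤ 1 := fun n => (norm_le_of_matrixNormLE ha0 ha1 h n).trans <| by
    rw [div_le_one (by positivity)]
    have : (0 : ℝ) ≤ n := by positivity
    linarith
  obtain ⟨T, hT, hT1⟩ := h
  have hφ : Memℓp (fun n => ((√‖v n‖ * ‖ψ n‖ : ℝ) : ℂ)) 2 := by
    refine memℓp_two_of_summable (Summable.of_nonneg_of_le (fun _ => by positivity) (fun n => ?_)
      (summable_norm_sq ψ))
    rw [Complex.norm_real, Real.norm_eq_abs, sq_abs, mul_pow, Real.sq_sqrt (norm_nonneg _)]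
    exact mul_le_of_le_one_left (by positivity) (hv1 n)
  set φ : SeqSpace := ⟨_, hφ⟩ with hφdef
  have hφn : ∀ n, φ n = ((√‖v n‖ * ‖ψ n‖ : ℝ) : ℂ) := fun _ => rfl
  have hrep := exists_apply_eq_neg_inner_greenFun ha0 ha1 hk0 hk hψ
  obtain ⟨χ, hχ⟩ : ∃ χ, χ = potentialOp ⟨v, hv⟩ ψ := ⟨_, rfl⟩
  have hVn : ∀ n, χ n = v n * ψ n := fun n => by rw [hχ, potentialOp_apply]
  rw [← hχ] at hrep
  -- Taking absolute values in the Green representation loses nothing that matters, since `K'` and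
  -- `φ` have nonnegative entries.
  have hle : ∀ m, ‖φ m‖ ≤ ‖k‖ * ‖T φ m‖ := by
    intro m
    obtain ⟨g, hg, hgm⟩ := hrep m
    have h1 := (lp.hasSum_inner (𝕜 := ℂ) g χ).mul_left (√‖v m‖ : ℂ)
    have h2 := (Complex.hasSum_re (hT.hasSum φ m)).mul_left ‖k‖
    have h3 := h1.norm_le_of_bounded h2 fun n => by
      have h4 : ‖g n‖ ≤ ‖k‖ * (a / (1 - a) + ((min m n : ℕ) + 1)) := by
        have := norm_greenFun_le ha0 ha1 (k := star k) (by rw [norm_star]; exact hk.le) m n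
        rwa [norm_star, ← hg] at this
      rw [hVn, hφn, hardyKernel, ← Complex.ofReal_mul, Complex.ofReal_re, norm_mul, Complex.norm_real,
        Real.norm_of_nonneg (Real.sqrt_nonneg _)]
      have h5 := norm_inner_le_norm (𝕜 := ℂ) (g n) (v n * ψ n)
      rw [norm_mul (v n)] at h5
      calc √‖v m‖ * ‖inner ℂ (g n) (v n * ψ n)‖
          ≤ √‖v m‖ * (‖k‖ * (a / (1 - a) + ((min m n : ℕ) + 1)) * (‖v n‖ * ‖ψ n‖)) := by
            gcongr
            exact h5.trans (by gcongr)
        _ = _ := by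
            nth_rewrite 1 [← Real.mul_self_sqrt (norm_nonneg (v n))]
            ring
    have h6 : ‖φ m‖ = ‖(√‖v m‖ : ℂ) * inner ℂ g χ‖ := by
      rw [hφn, Complex.norm_real, norm_mul, norm_mul, Complex.norm_real, norm_norm, hgm,
        norm_neg]
    rw [h6]
    refine h3.trans ?_
    gcongr
    exact Complex.re_le_norm _
  have hφ2 : ‖φ‖ ^ 2 ≤ ‖k‖ ^ 2 * ‖φ‖ ^ 2 := by
    refine norm_sq_le_of_sum_le fun N => ?_
    calc ∑ n ∈ Finset.range N, ‖φ n‖ ^ 2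
        ≤ ∑ n ∈ Finset.range N, ‖k‖ ^ 2 * ‖T φ n‖ ^ 2 := by
          refine Finset.sum_le_sum fun n _ => ?_
          rw [← mul_pow]
          exact pow_le_pow_left₀ (norm_nonneg _) (hle n) 2
      _ ≤ ‖k‖ ^ 2 * ‖T φ‖ ^ 2 := by
          rw [← Finset.mul_sum]
          gcongr
          exact sum_norm_sq_le _ _
      _ ≤ ‖k‖ ^ 2 * ‖φ‖ ^ 2 := by
          gcongr
          exact (T.le_of_opNorm_le hT1 φ).trans (one_mul _).le
  have hφ0 : φ = 0 := by
    rw [← norm_eq_zero, ← sq_eq_zero_iff]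
    have hk2 : ‖k‖ ^ 2 < 1 := by nlinarith [norm_nonneg k]
    nlinarith [sq_nonneg ‖φ‖]
  -- At each site `v n` or `ψ n` vanishes, so `V ψ = 0`; the Green representation then gives `ψ =
  -- 0`.
  have hW : χ = 0 := by
    ext n
    have h1 : φ n = 0 := by rw [hφ0]; rfl
    rw [hφn, Complex.ofReal_eq_zero, mul_eq_zero, Real.sqrt_eq_zero (norm_nonneg _), norm_eq_zero,
      norm_eq_zero] at h1
    rw [hVn]
    exact mul_eq_zero.2 h1
  ext m
  obtain ⟨g, -, hgm⟩ := hrep m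
  rw [hgm, hW, inner_zero_right, neg_zero]
  rfl

/-! ### The interval `[-2, 2]` lies in the spectrum -/

theorem summable_norm_sq_pow {k : ℂ} (hk : ‖k‖ < 1) : Summable fun n : ℕ => ‖k ^ n‖ ^ 2 := by
  refine (summable_geometric_of_lt_one (sq_nonneg ‖k‖) (by nlinarith [norm_nonneg k])).congr
    fun n => ?_
  rw [norm_pow]
  ring

/-- The geometric sequence `1, k, k ^ 2, …` as an element of `ℓ²`. -/
noncomputable def geomSeq {k : ℂ} (hk : ‖k‖ < 1) : SeqSpace :=
  ⟨fun n => k ^ n, memℓp_two_of_summable (summable_norm_sq_pow hk)⟩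

theorem norm_geomSeq {k : ℂ} (hk : ‖k‖ < 1) : ‖geomSeq hk‖ = (√(1 - ‖k‖ ^ 2))⁻¹ := by
  have h1 : ‖k‖ ^ 2 < 1 := by nlinarith [norm_nonneg k]
  have h2 : ‖geomSeq hk‖ ^ 2 = (1 - ‖k‖ ^ 2)⁻¹ := by
    rw [norm_sq_eq_tsum, ← tsum_geometric_of_lt_one (sq_nonneg _) h1]
    refine tsum_congr fun n => ?_
    change ‖k ^ n‖ ^ 2 = _
    rw [norm_pow]
    ring
  rw [← Real.sqrt_inv, ← h2, Real.sqrt_sq (norm_nonneg _)]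

theorem jacobiOp_geomSeq (a : ℂ) {k : ℂ} (hk0 : k ≠ 0) (hk : ‖k‖ < 1) :
    jacobiOp a (geomSeq hk) = (k + k⁻¹) • geomSeq hk + lp.single 2 0 (a - k⁻¹) := by
  ext n
  rw [jacobiOp_apply, lp.coeFn_add, Pi.add_apply, lp.coeFn_smul, Pi.smul_apply, lp.single_apply]
  simp only [geomSeq, Pi.single_apply, smul_eq_mul]
  rcases n with _ | n
  · simp
    ring
  · simp only [Nat.add_eq_zero_iff, one_ne_zero, and_false, if_false, Nat.add_sub_cancel]
    field_simp
    ring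

theorem summable_sq_one_div : Summable fun n : ℕ => (1 / ((n : ℝ) + 1)) ^ 2 := by
  refine ((summable_nat_add_iff 1).2 (Real.summable_one_div_nat_pow (p := 2).2 one_lt_two)).congr
    fun n => ?_
  push_cast
  rw [div_pow, one_pow]

theorem norm_potentialOp_geomSeq_le {v : lp (fun _ : ℕ => ℂ) ∞}
    (hv1 : ∀ n, ‖v n‖ ≤ 1 / ((n : ℝ) + 1)) {k : ℂ} (hk : ‖k‖ < 1) :
    ‖potentialOp v (geomSeq hk)‖ ≤ √(∑' n : ℕ, (1 / ((n : ℝ) + 1)) ^ 2) := by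
  refine Real.le_sqrt_of_sq_le (norm_sq_le_of_sum_le fun N => ?_)
  refine le_trans (Finset.sum_le_sum fun n _ => ?_)
    (summable_sq_one_div.sum_le_tsum (Finset.range N) fun _ _ => by positivity)
  rw [potentialOp_apply, norm_mul]
  gcongr
  refine (mul_le_of_le_one_right (norm_nonneg _) ?_).trans (hv1 n)
  change ‖k ^ n‖ ≤ 1
  rw [norm_pow]
  exact pow_le_one₀ (norm_nonneg _) hk.le

/-- The sequences `(r z)ⁿ` are approximate eigenvectors as `r → 1`: their norms blow up, while the
boundary term and the potential term stay bounded, the latter because `1 / (n + 1)` is square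
summable. -/
theorem add_inv_mem_spectrum (a : ℂ) {v : lp (fun _ : ℕ => ℂ) ∞}
    (hv1 : ∀ n, ‖v n‖ ≤ 1 / ((n : ℝ) + 1)) {z : ℂ} (hz : ‖z‖ = 1) :
    z + z⁻¹ ∈ spectrum ℂ (jacobiOp a + potentialOp v) := by
  by_contra hmem
  obtain ⟨u, hu⟩ := spectrum.notMem_iff.1 hmem
  have hz0 : z ≠ 0 := norm_ne_zero_iff.1 (by rw [hz]; exact one_ne_zero)
  set R := ‖(↑u⁻¹ : SeqSpace →L[ℂ] SeqSpace)‖ with hR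
  set C := √(∑' n : ℕ, (1 / ((n : ℝ) + 1)) ^ 2) with hC
  -- `F r` bounds `R` times the norm of the residual divided by `‖ψ‖ = 1 / √(1 - r²)`. A bounded
  -- inverse would force `F r ≥ 1`, but `F r → 0`.
  set F : ℝ → ℝ := fun r => R * (‖z + z⁻¹ - (r * z + (r * z)⁻¹)‖ +
    √(1 - r ^ 2) * (‖a - (r * z)⁻¹‖ + C)) with hF
  have hle : ∀ r : ℝ, 0 < r → r < 1 → 1 ≤ F r := by
    intro r hr0 hr1
    have hrc : (r : ℂ) ≠ 0 := by exact_mod_cast hr0.ne'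
    have hkn : ‖(r : ℂ) * z‖ = r := by
      rw [norm_mul, hz, mul_one, Complex.norm_real, Real.norm_of_nonneg hr0.le]
    have hk : ‖(r : ℂ) * z‖ < 1 := by rwa [hkn]
    set k : ℂ := r * z with hkdef
    set ψ := geomSeq hk with hψ
    have hs : 0 < √(1 - r ^ 2) := Real.sqrt_pos.2 (by nlinarith)
    have hψn : ‖ψ‖ = (√(1 - r ^ 2))⁻¹ := by rw [hψ, norm_geomSeq, hkn]
    have e1 : (u : SeqSpace →L[ℂ] SeqSpace) ψ = (z + z⁻¹ - (k + k⁻¹)) • ψ -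
        lp.single 2 0 (a - k⁻¹) - potentialOp v ψ := by
      rw [hu, sub_apply, add_apply,
        Algebra.algebraMap_eq_smul_one, smul_apply,
        one_apply_eq_self, jacobiOp_geomSeq a (mul_ne_zero hrc hz0) hk, sub_smul]
      abel
    have e2 : ψ = (↑u⁻¹ : SeqSpace →L[ℂ] SeqSpace) ((u : SeqSpace →L[ℂ] SeqSpace) ψ) := by
      rw [← mul_apply_eq_comp, Units.inv_mul, one_apply_eq_self]
    have e3 : ‖ψ‖ ≤ R * (‖z + z⁻¹ - (k + k⁻¹)‖ * ‖ψ‖ + ‖a - k⁻¹‖ + C) := by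
      nth_rewrite 1 [e2]
      refine (ContinuousLinearMap.le_opNorm _ _).trans ?_
      rw [e1]
      refine mul_le_mul_of_nonneg_left ?_ (norm_nonneg _)
      refine (norm_sub_le _ _).trans (add_le_add ((norm_sub_le _ _).trans (add_le_add ?_ ?_)) ?_)
      · exact (norm_smul _ _).le
      · exact (lp.norm_single (by norm_num) _ _).le
      · exact norm_potentialOp_geomSeq_le hv1 hk
    rw [hψn] at e3
    have e4 := mul_le_mul_of_nonneg_right e3 hs.le
    rw [inv_mul_cancel₀ hs.ne'] at e4
    refine e4.trans (le_of_eq ?_)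
    change _ = R * (‖z + z⁻¹ - (k + k⁻¹)‖ + √(1 - r ^ 2) * (‖a - k⁻¹‖ + C))
    linear_combination R * ‖z + z⁻¹ - (k + k⁻¹)‖ * inv_mul_cancel₀ hs.ne'
  have hcont : ContinuousAt F 1 := by
    have hinv : ContinuousAt (fun r : ℝ => ((r : ℂ) * z)⁻¹) 1 :=
      ContinuousAt.inv₀ (by fun_prop) (by simpa using hz0)
    have hlin : ContinuousAt (fun r : ℝ => (r : ℂ) * z) 1 := by fun_prop
    exact continuousAt_const.mul (((continuousAt_const.sub (hlin.add hinv)).norm).add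
      ((by fun_prop : ContinuousAt (fun r : ℝ => √(1 - r ^ 2)) 1).mul
        ((continuousAt_const.sub hinv).norm.add continuousAt_const)))
  have hF1 : F 1 = 0 := by simp [hF]
  have hlim : Filter.Tendsto F (nhdsWithin 1 (Set.Iio 1)) (nhds 0) := by
    rw [← hF1]
    exact hcont.tendsto.mono_left nhdsWithin_le_nhds
  have h1 : (1 : ℝ) ≤ 0 := by
    refine ge_of_tendsto hlim ?_
    filter_upwards [Ioo_mem_nhdsLT (show (0 : ℝ) < 1 by norm_num)] with r hr
    exact hle r hr.1 hr.2
  exact absurd h1 (by norm_num)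

theorem ofReal_mem_spectrum (a : ℂ) {v : lp (fun _ : ℕ => ℂ) ∞}
    (hv1 : ∀ n, ‖v n‖ ≤ 1 / ((n : ℝ) + 1)) {t : ℝ} (ht : |t| ≤ 2) :
    (t : ℂ) ∈ spectrum ℂ (jacobiOp a + potentialOp v) := by
  have h := abs_le.1 ht
  have hn : ‖Complex.exp ((Real.arccos (t / 2) : ℝ) * Complex.I)‖ = 1 :=
    Complex.norm_exp_ofReal_mul_I _
  have key := add_inv_mem_spectrum a hv1 hn
  have e : Complex.exp ((Real.arccos (t / 2) : ℝ) * Complex.I) +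
      (Complex.exp ((Real.arccos (t / 2) : ℝ) * Complex.I))⁻¹ = (t : ℂ) := by
    rw [← Complex.exp_neg, ← neg_mul, ← Complex.two_cos, ← Complex.ofReal_cos,
      Real.cos_arccos (by linarith) (by linarith)]
    push_cast
    ring
  rwa [e] at key

/-! ### Emptiness of the discrete spectrum -/

/-- The roots of `x² - μ x + 1` are mutually inverse, so one lies in the closed unit disc. -/
theorem exists_eq_add_inv (μ : ℂ) : ∃ k : ℂ, k ≠ 0 ∧ ‖k‖ ≤ 1 ∧ μ = k + k⁻¹ := by
  obtain ⟨x, hx⟩ := exists_quadratic_eq_zero (K := ℂ) (a := 1) (b := -μ) (c := 1) one_ne_zero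
    (by obtain ⟨s, hs⟩ := IsAlgClosed.exists_pow_nat_eq (discrim 1 (-μ) 1) (n := 2) two_pos
        exact ⟨s, by rw [← hs, sq]⟩)
  have hx0 : x ≠ 0 := by
    rintro rfl
    simp at hx
  have hμ : μ = x + x⁻¹ := by
    field_simp
    linear_combination -hx
  rcases le_total ‖x‖ 1 with h | h
  · exact ⟨x, hx0, h, hμ⟩
  · refine ⟨x⁻¹, inv_ne_zero hx0, ?_, by rw [inv_inv, hμ, add_comm]⟩
    rw [norm_inv]
    exact inv_le_one_of_one_le₀ h

theorem discreteSpectrum_eq_empty {a : ℝ} (ha0 : 0 ≤ a) (ha1 : a < 1) {v : ℕ → ℂ}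
    (h : MatrixNormLE (hardyKernel a v) 1) (hv : Memℓp v ⊤) :
    discreteSpectrum (jacobiOp (a : ℂ) + potentialOp ⟨v, hv⟩) = ∅ := by
  rw [Set.eq_empty_iff_forall_notMem]
  rintro μ ⟨hμ, r, hr, hiso, -⟩
  obtain ⟨ψ, hψ, hψ0⟩ := hμ.exists_hasEigenvector
  rw [Module.End.mem_eigenspace_iff] at hψ
  obtain ⟨k, hk0, hk1, rfl⟩ := exists_eq_add_inv μ
  rcases hk1.lt_or_eq with hk | hk
  · exact hψ0 (eq_zero_of_eigenvector ha0 ha1 h hv hk0 hk hψ)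
  · have hinv : k⁻¹ = star k := by
      rw [Complex.inv_def, Complex.normSq_eq_norm_sq, hk]
      simp
    have hre : k + k⁻¹ = ((2 * k.re : ℝ) : ℂ) := by
      rw [hinv]
      exact Complex.add_conj k
    have ht := Complex.abs_re_le_norm k
    rw [hk, abs_le] at ht
    rw [hre] at hiso
    have hε : 0 < min r 1 := lt_min hr one_pos
    have hε1 := min_le_right r 1
    have hεr := min_le_left r 1
    -- A second spectral point in the isolating disc: moving towards the origin, by at most `1`,
    -- stays inside `[-2, 2]`.
    obtain ⟨s, hs, hs2⟩ : ∃ s : ℝ, |s - 2 * k.re| = min r 1 ∧ |s| ≤ 2 := by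
      rcases le_total 0 k.re with hp | hp
      · refine ⟨2 * k.re - min r 1, ?_, abs_le.2 ⟨by linarith, by linarith⟩⟩
        rw [sub_sub_cancel_left, abs_neg, abs_of_pos hε]
      · refine ⟨2 * k.re + min r 1, ?_, abs_le.2 ⟨by linarith, by linarith⟩⟩
        rw [add_sub_cancel_left, abs_of_pos hε]
    have hmem : (s : ℂ) ∈ ({((2 * k.re : ℝ) : ℂ)} : Set ℂ) := by
      rw [← hiso]
      refine ⟨ofReal_mem_spectrum _ (norm_le_of_matrixNormLE ha0 ha1 h) hs2, ?_⟩
      rw [Metric.mem_closedBall, dist_eq_norm, ← Complex.ofReal_sub, Complex.norm_real,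
        Real.norm_eq_abs, hs]
      exact hεr
    rw [Set.mem_singleton_iff, Complex.ofReal_inj] at hmem
    rw [hmem, sub_self, abs_zero] at hs
    exact hε.ne hs

theorem memℓp_top_of_matrixNormLE {a : ℝ} (ha0 : 0 ≤ a) (ha1 : a < 1) {v : ℕ → ℂ}
    (h : MatrixNormLE (hardyKernel a v) 1) : Memℓp v ⊤ := by
  refine memℓp_infty ⟨1, ?_⟩
  rintro _ ⟨n, rfl⟩
  refine (norm_le_of_matrixNormLE ha0 ha1 h n).trans ?_
  rw [div_le_one (by positivity)]
  have : (0 : ℝ) ≤ n := by positivity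
  linarith

end RobinLaplacian

theorem theorem5p4 (a : ℝ) (ha0 : 0 ≤ a) (ha1 : a < 1) (v : ℕ → ℂ) :
    (MatrixNormLE (hardyKernel a v) 1 ↔ AbsPotentialLE v (negLaplacian (a : ℂ))) ∧
    (MatrixNormLE (hardyKernel a v) 1 →
      ∃ hv : Memℓp v ⊤, discreteSpectrum (jacobiOp (a : ℂ) + potentialOp ⟨v, hv⟩) = ∅) ∧
    (AbsPotentialLE v (negLaplacian (a : ℂ)) →
      ∃ hv : Memℓp v ⊤, discreteSpectrum (jacobiOp (a : ℂ) + potentialOp ⟨v, hv⟩) = ∅) := by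
  have main : MatrixNormLE (hardyKernel a v) 1 →
      ∃ hv : Memℓp v ⊤, discreteSpectrum (jacobiOp (a : ℂ) + potentialOp ⟨v, hv⟩) = ∅ := fun h =>
    ⟨memℓp_top_of_matrixNormLE ha0 ha1 h, discreteSpectrum_eq_empty ha0 ha1 h _⟩
  exact ⟨⟨absPotentialLE_of_matrixNormLE ha1, matrixNormLE_of_absPotentialLE ha1⟩, main,
    fun h => main (matrixNormLE_of_absPotentialLE ha1 h)⟩
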